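/- A \emph{KTB-algebra} is a Boolean algebra $A$ (with constants $0,1$) together with a unary operation $\Diamond$ such that $\Diamond 0=0$, $\Diamond(x\vee y)=\Diamond x\vee\Diamond y$, $x\le\Diamond x$ and $x\le\neg\Diamond\neg\Diamond x$ for all $x,y\in A$. Subvarieties of the variety $\mathcal{B}$ of KTB-algebras are ordered by inclusion, and $\mathrm{Var}(\mathbf{A})=\mathrm{HSP}(\mathbf{A})$ is the variety generated by $\mathbf{A}$. A subvariety $\mathcal{V}$ has \emph{height} $n$ if there are subvarieties $\mathcal{V}_0\prec\mathcal{V}_1\prec\dots\prec\mathcal{V}_n=\mathcal{V}$ in which $\mathcal{V}_0$ is the variety of one-element algebras and each $\mathcal{V}_{i+1}$ covers $\mathcal{V}_i$. For a simple graph $G$ on a vertex set $V$, $\mathsf{Cm}(\mathbb{G})$ denotes the KTB-algebra of all subsets of $V$, where $\Diamond X$ is the set of vertices that are equal or adjacent to a member of $X$; in particular $\mathsf{Cm}(\mathbb{K}_2)$ is the one for the complete graph on two vertices. Let $\mathbb{E}$ be the set of positive even integers and let $N\subseteq\mathbb{E}$. Let $\mathbb{F}_N$ be the graph (loops at all vertices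 being understood) whose vertices are the pairwise distinct elements $a,b_1,b_2,b_3,c_1,c_2,d$, $u_i$ ($i\ge 1$) and $\ell_i$ ($i\ge 0$), and whose edges are \begin{itemize} \item $\{a,b_1\},\{a,b_2\},\{a,b_3\},\{b_1,c_1\},\{b_2,c_2\},\{c_1,d\},\{\ell_0,\ell_1\}$; \item $\{a,\ell_i\}$ for $i\ge 0$, and $\{\ell_i,u_i\}$ for $i\ge 1$; \item $\{\ell_i,u_{i-1}\}$ for $i\in\mathbb{E}$; \item $\{\ell_i,u_{i+1}\}$ for $i\in N$, and $\{\ell_{i+1},u_i\}$ for $i\in\mathbb{E}\setminus N$. \end{itemize} Let $\mathbf{D}_N$ be the subalgebra of $\mathsf{Cm}(\mathbb{F}_N)$ generated by the element $\{d\}$. Then, for every $N\subseteq\mathbb{E}$, the variety $\mathrm{Var}(\mathbf{D}_N)$ has height $3$ in the lattice of subvarieties of $\mathcal{B}$; also, the maximal length of a strictly increasing chain of subvarieties ending at $\mathrm{Var}(\mathbf{D}_N)$ is $3$. Moreover, $\mathrm{Var}(\mathbf{D}_N)$ covers $\mathrm{Var}(\mathsf{Cm}(\mathbb{K}_2))$.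 -/

import Mathlib

namespace KTB

/-- A KTB-operator `◇` on a Boolean algebra (possibly trivial).
With `□ x = ¬ ◇ ¬ x`, the last axiom is `x ≤ □ ◇ x`. -/
class KTBAlgebra (A : Type) [BooleanAlgebra A] where
  dia : A → A
  dia_bot : dia ⊥ = ⊥
  dia_sup : ∀ x y : A, dia (x ⊔ y) = dia x ⊔ dia y
  le_dia : ∀ x : A, x ≤ dia x
  le_box_dia : ∀ x : A, x ≤ (dia (dia x)ᶜ)ᶜ

/-- A KTB-algebra together with its carrier. -/
structure KTBAlg where
  carrier : Type
  [bool : BooleanAlgebra carrier]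
  [ktb : KTBAlgebra carrier]

attribute [instance] KTBAlg.bool KTBAlg.ktb

instance : CoeSort KTBAlg Type := ⟨KTBAlg.carrier⟩

/-- The operator `◇` of a KTB-algebra. -/
def dia {A : KTBAlg} (x : A) : A := KTBAlgebra.dia x

/-- A homomorphism of KTB-algebras: it preserves the lattice operations, `0` and `1` (hence
complements) and `◇`. -/
structure KTBHom (A B : KTBAlg) extends BoundedLatticeHom A B where
  map_dia' : ∀ x : A, toFun (dia x) = dia (toFun x)

/-- A (universe of a) subalgebra of a KTB-algebra. -/
structure KTBSubalgebra (A : KTBAlg) extends BooleanSubalgebra A where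
  dia_mem' : ∀ x ∈ carrier, dia x ∈ carrier

/-- A subalgebra, seen as a KTB-algebra with the restricted operations. -/
def KTBSubalgebra.toAlg {A : KTBAlg} (S : KTBSubalgebra A) : KTBAlg where
  carrier := S.toBooleanSubalgebra
  ktb :=
    { dia := fun x => ⟨dia x.1, S.dia_mem' x.1 x.2⟩
      dia_bot := Subtype.ext (KTBAlgebra.dia_bot (A := A))
      dia_sup := fun x y => Subtype.ext (KTBAlgebra.dia_sup x.1 y.1)
      le_dia := fun x => KTBAlgebra.le_dia x.1
      le_box_dia := fun x => KTBAlgebra.le_box_dia x.1 }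

/-- The subalgebra generated by a subset: the intersection of all subalgebras containing it. -/
def generate {A : KTBAlg} (s : Set A) : KTBSubalgebra A where
  carrier := {x | ∀ T : KTBSubalgebra A, s ⊆ T.carrier → x ∈ T.carrier}
  supClosed' := fun _ hx _ hy T hT => T.supClosed' (hx T hT) (hy T hT)
  infClosed' := fun _ hx _ hy T hT => T.infClosed' (hx T hT) (hy T hT)
  compl_mem' := fun hx T hT => T.compl_mem' (hx T hT)
  bot_mem' := fun T _ => T.bot_mem'
  dia_mem' := fun x hx T hT => T.dia_mem' x (hx T hT)

/-- The direct product of a family of KTB-algebras. -/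
def prod {I : Type} (A : I → KTBAlg) : KTBAlg where
  carrier := ∀ i, A i
  ktb :=
    { dia := fun x i => dia (x i)
      dia_bot := funext fun _ => KTBAlgebra.dia_bot
      dia_sup := fun x y => funext fun i => KTBAlgebra.dia_sup (x i) (y i)
      le_dia := fun x i => KTBAlgebra.le_dia (x i)
      le_box_dia := fun x i => KTBAlgebra.le_box_dia (x i) }

/-! ### Varieties -/

/-- A subvariety of the variety of KTB-algebras: a class of KTB-algebras closed under homomorphic
images (so also under isomorphic copies), subalgebras and direct products. -/
structure Subvariety where
  carrier : Set KTBAlg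
  hom_closed : ∀ {A B : KTBAlg} (f : KTBHom A B), Function.Surjective f.toFun →
    A ∈ carrier → B ∈ carrier
  sub_closed : ∀ {A : KTBAlg} (S : KTBSubalgebra A), A ∈ carrier → S.toAlg ∈ carrier
  prod_closed : ∀ {I : Type} (A : I → KTBAlg), (∀ i, A i ∈ carrier) → prod A ∈ carrier

theorem Subvariety.carrier_injective : Function.Injective Subvariety.carrier := by
  rintro ⟨_, _, _, _⟩ ⟨_, _, _, _⟩ h
  cases h
  rfl

/-- Subvarieties are ordered by inclusion. -/
instance : PartialOrder Subvariety :=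
  PartialOrder.lift Subvariety.carrier Subvariety.carrier_injective

/-- The least subvariety consists of the trivial (one-element) algebras. -/
instance : OrderBot Subvariety where
  bot :=
    { carrier := {A | Subsingleton A}
      hom_closed := fun {A _} _ hf hA =>
        have : Subsingleton A := hA
        hf.subsingleton
      sub_closed := fun {A} _ hA =>
        have : Subsingleton A := hA
        inferInstanceAs (Subsingleton (Subtype _))
      prod_closed := fun A hA =>
        have : ∀ i, Subsingleton (A i) := hA
        inferInstanceAs (Subsingleton (∀ i, A i)) }
  bot_le := fun V A hA => by
    have hA' : Subsingleton A := hA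
    let E : KTBAlg := prod (fun i : Empty => i.elim)
    have hE : E ∈ V.carrier := V.prod_closed _ (fun i => i.elim)
    let f : KTBHom E A :=
      { toFun := fun _ => ⊥
        map_sup' := fun _ _ => Subsingleton.elim _ _
        map_inf' := fun _ _ => Subsingleton.elim _ _
        map_top' := Subsingleton.elim _ _
        map_bot' := rfl
        map_dia' := fun _ => Subsingleton.elim _ _ }
    exact V.hom_closed f (fun y => ⟨⊥, Subsingleton.elim _ _⟩) hE

/-- The variety `Var(C) = HSP(C)` generated by a class `C` of KTB-algebras. -/
def Var (C : Set KTBAlg) : Subvariety where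
  carrier := {A | ∃ (I : Type) (B : I → KTBAlg) (S : KTBSubalgebra (prod B)) (f : KTBHom S.toAlg A),
    (∀ i, B i ∈ C) ∧ Function.Surjective f.toFun}
  hom_closed := by
    rintro A A' g hg ⟨I, B, S, f, hB, hf⟩
    refine ⟨I, B, S, { g.toBoundedLatticeHom.comp f.toBoundedLatticeHom with
      map_dia' := fun x => ?_ }, hB, hg.comp hf⟩
    exact (congrArg g.toFun (f.map_dia' x)).trans (g.map_dia' _)
  sub_closed := by
    rintro A T ⟨I, B, S, f, hB, hf⟩
    let S' : KTBSubalgebra (prod B) :=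
      { carrier := {x | ∃ h : x ∈ S.carrier, f.toFun ⟨x, h⟩ ∈ T.carrier}
        supClosed' := fun x ⟨hx, hx'⟩ y ⟨hy, hy'⟩ => ⟨S.supClosed' hx hy, by
          have e := f.map_sup' (⟨x, hx⟩ : S.toAlg) (⟨y, hy⟩ : S.toAlg)
          exact Set.mem_of_eq_of_mem e (T.supClosed' hx' hy')⟩
        infClosed' := fun x ⟨hx, hx'⟩ y ⟨hy, hy'⟩ => ⟨S.infClosed' hx hy, by
          have e := f.map_inf' (⟨x, hx⟩ : S.toAlg) (⟨y, hy⟩ : S.toAlg)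
          exact Set.mem_of_eq_of_mem e (T.infClosed' hx' hy')⟩
        compl_mem' := fun {x} ⟨hx, hx'⟩ => ⟨S.compl_mem' hx, by
          have e := map_compl' f.toBoundedLatticeHom (show S.toAlg from ⟨x, hx⟩)
          exact Set.mem_of_eq_of_mem e (T.compl_mem' hx')⟩
        bot_mem' := ⟨S.bot_mem', Set.mem_of_eq_of_mem f.map_bot' T.bot_mem'⟩
        dia_mem' := fun x ⟨hx, hx'⟩ => ⟨S.dia_mem' x hx, by
          have e := f.map_dia' (⟨x, hx⟩ : S.toAlg)
          exact Set.mem_of_eq_of_mem e (T.dia_mem' _ hx')⟩ }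
    refine ⟨I, B, S',
      { toFun := fun x => ⟨f.toFun ⟨x.1, x.2.1⟩, x.2.2⟩
        map_sup' := fun x y => Subtype.ext (f.map_sup' ⟨x.1, x.2.1⟩ ⟨y.1, y.2.1⟩)
        map_inf' := fun x y => Subtype.ext (f.map_inf' ⟨x.1, x.2.1⟩ ⟨y.1, y.2.1⟩)
        map_top' := Subtype.ext f.map_top'
        map_bot' := Subtype.ext f.map_bot'
        map_dia' := fun x => Subtype.ext (f.map_dia' ⟨x.1, x.2.1⟩) }, hB, ?_⟩
    rintro ⟨y, hy⟩
    obtain ⟨⟨x, hx⟩, rfl⟩ := hf y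
    exact ⟨⟨x, hx, hy⟩, rfl⟩
  prod_closed := by
    intro J A hA
    choose I B S f hB hf using hA
    let S' : KTBSubalgebra (prod fun p : Σ j, I j => B p.1 p.2) :=
      { carrier := {x | ∀ j, (fun i => x ⟨j, i⟩) ∈ (S j).carrier}
        supClosed' := fun x hx y hy j => (S j).supClosed' (hx j) (hy j)
        infClosed' := fun x hx y hy j => (S j).infClosed' (hx j) (hy j)
        compl_mem' := fun hx j => (S j).compl_mem' (hx j)
        bot_mem' := fun j => (S j).bot_mem'
        dia_mem' := fun x hx j => (S j).dia_mem' _ (hx j) }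
    refine ⟨Σ j, I j, fun p => B p.1 p.2, S',
      { toFun := fun x j => (f j).toFun ⟨fun i => x.1 ⟨j, i⟩, x.2 j⟩
        map_sup' := fun x y => funext fun j => (f j).map_sup' ⟨_, x.2 j⟩ ⟨_, y.2 j⟩
        map_inf' := fun x y => funext fun j => (f j).map_inf' ⟨_, x.2 j⟩ ⟨_, y.2 j⟩
        map_top' := funext fun j => (f j).map_top'
        map_bot' := funext fun j => (f j).map_bot'
        map_dia' := fun x => funext fun j => (f j).map_dia' ⟨_, x.2 j⟩ },
      fun p => hB p.1 p.2, ?_⟩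
    intro y
    choose x hx using fun j => hf j (y j)
    exact ⟨⟨fun p => (x p.1).1 p.2, fun j => (x j).2⟩, funext hx⟩

/-- `Var(C)` is the least subvariety containing `C`. -/
theorem Var_le_iff (C : Set KTBAlg) (V : Subvariety) : Var C ≤ V ↔ C ⊆ V.carrier := by
  constructor
  · intro h A hA
    apply h
    let S : KTBSubalgebra (prod fun _ : Unit => A) :=
      { carrier := Set.univ
        supClosed' := fun _ _ _ _ => trivial
        infClosed' := fun _ _ _ _ => trivial
        compl_mem' := fun _ => trivial
        bot_mem' := trivial
        dia_mem' := fun _ _ => trivial }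
    exact ⟨Unit, fun _ => A, S,
      { toFun := fun x => x.1 ()
        map_sup' := fun _ _ => rfl
        map_inf' := fun _ _ => rfl
        map_top' := rfl
        map_bot' := rfl
        map_dia' := fun _ => rfl }, fun _ => hA, fun y => ⟨⟨fun _ => y, trivial⟩, rfl⟩⟩
  · rintro h A ⟨I, B, S, f, hB, hf⟩
    exact V.hom_closed f hf (V.sub_closed S (V.prod_closed B fun i => h (hB i)))

/-- `V` has height `n` in the lattice of subvarieties: there is a chain of covers of length `n`
leading from the trivial variety to `V`. -/
def HasHeight (n : ℕ) (V : Subvariety) : Prop :=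
  ∃ c : ℕ → Subvariety, c 0 = ⊥ ∧ c n = V ∧ ∀ i < n, c i ⋖ c (i + 1)

/-! ### Complex algebras of graphs -/

/-- The complex algebra `Cm(𝔾)` of the reflexive closure `𝔾` of a simple graph `G`: all sets of
vertices, with `◇ X` the set of vertices that are equal or adjacent to a vertex in `X`. -/
def Cm {V : Type} (G : SimpleGraph V) : KTBAlg where
  carrier := Set V
  ktb :=
    { dia := fun X => {x | ∃ y ∈ X, x = y ∨ G.Adj x y}
      dia_bot := by
        ext x
        simp
      dia_sup := fun X Y => by
        ext x
        simp only [Set.sup_eq_union, Set.mem_union, Set.mem_ofPred_eq]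
        constructor
        · rintro ⟨y, hy | hy, h⟩
          · exact Or.inl ⟨y, hy, h⟩
          · exact Or.inr ⟨y, hy, h⟩
        · rintro (⟨y, hy, h⟩ | ⟨y, hy, h⟩)
          · exact ⟨y, Or.inl hy, h⟩
          · exact ⟨y, Or.inr hy, h⟩
      le_dia := fun X x hx => ⟨x, hx, Or.inl rfl⟩
      le_box_dia := fun X x hx => by
        rintro ⟨y, hy, h⟩
        apply hy
        rcases h with rfl | h
        · exact ⟨x, hx, Or.inl rfl⟩
        · exact ⟨x, hx, Or.inr h.symm⟩ }

/-! ### The graphs `F_N` and the algebras `D_N` -/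

/-- The set of positive even numbers. -/
def posEven : Set ℕ := {i | 0 < i ∧ Even i}

/-- The vertices of `F_N`. The vertices `u i` are indexed by the positive integers, the vertices
`l i` by all natural numbers. -/
inductive W : Type
  | a | b1 | b2 | b3 | c1 | c2 | d
  | u (i : ℕ) (hi : i ≠ 0)
  | l (i : ℕ)

/-- The edges of `F_N`, each listed in one direction. -/
inductive Edge (N : Set ℕ) : W → W → Prop
  | a_b1 : Edge N .a .b1
  | a_b2 : Edge N .a .b2
  | a_b3 : Edge N .a .b3
  | b1_c1 : Edge N .b1 .c1
  | b2_c2 : Edge N .b2 .c2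
  | c1_d : Edge N .c1 .d
  | l0_l1 : Edge N (.l 0) (.l 1)
  | a_l (i : ℕ) : Edge N .a (.l i)
  | l_u (i : ℕ) (hi : i ≠ 0) : Edge N (.l i) (.u i hi)
  | l_u_pred (j : ℕ) (hj : j ≠ 0) : j + 1 ∈ posEven → Edge N (.l (j + 1)) (.u j hj)
  | l_u_succ (i : ℕ) : i ∈ N → Edge N (.l i) (.u (i + 1) i.succ_ne_zero)
  | l_succ_u (i : ℕ) (hi : i ≠ 0) : i ∈ posEven \ N → Edge N (.l (i + 1)) (.u i hi)

/-- The graph `F_N`, as a simple graph (the loops are added in the complex algebra). -/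
def F (N : Set ℕ) : SimpleGraph W := SimpleGraph.fromRel (Edge N)

/-- `D_N`, the subalgebra of `Cm(F_N)` generated by the set `{d}`. -/
def D (N : Set ℕ) : KTBAlg :=
  (generate (A := Cm (F N)) {({W.d} : Set W)}).toAlg

end KTB

/-!
A subalgebra of a power of `D N` is made of sequences of sets of vertices, and since `F N` has
diameter five, `dia^[5]` sends a sequence to the indicator of its support. This makes quotients of
such subalgebras accessible through ultrafilters on the index set: each nonzero element of a
quotient is already nonzero in some ultraproduct-like limit through which the quotient map factors
(`exists_compatible_ultrafilter`).

The combinatorial heart is a dichotomy for a set `X` of vertices. Either `X` is empty, or it is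
dominating (`dia X = ⊤`), or one of finitely many terms, fixed in advance, turns `X` into the
generator `{d}` (`exists_separatorTerms_eval_eq`). If `X` is neither empty nor dominating, the
complement of its neighbourhood and the complement of the neighbourhood of the latter are two
nonempty sets without edges between them, each the complement of the neighbourhood of the other. The
vertices `a`, `b2`, `c2` and the pendant path `b1`, `c1`, `d` leave few positions for such a pair.
The edges between the `l i` and the `u i`, and hence `N`, play hardly any role: it matters only that
each `u i` is adjacent to `l i` and to no vertex other than the `l j`.

Let `V` be a subvariety of `Var {D N}`. If along some compatible ultrafilter one of the terms
produces `{d}` almost everywhere, then a subalgebra of a member of `V` maps onto `D N`, because `D N`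
is generated by `{d}` (`Subvariety.mem_of_eventually_eq_generator`). Otherwise, along each such
ultrafilter, each element is almost everywhere empty or dominating. As `a` is the only neighbour of
`b3`, a dominating set contains `a` or `b3`, so tracing sets on these two vertices is a homomorphism
into `Cm(K₂)`, and these homomorphisms separate points: `V` lies in `Var {Cm(K₂)}`
(`le_Var_complete_of_notMem`). The same argument with `Cm(K₂)` in place of `D N` and one vertex in
place of two shows that the proper subvarieties of `Var {Cm(K₂)}` lie in the variety of the
two-element algebra, which is contained in every nontrivial variety. Conversely `Cm(K₂)` embeds into
`D N` since a union of spheres around `d` and its complement are both dominating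
(`complete_two_mem`). So the subvarieties of `Var {D N}` form a four-element chain.
-/

namespace KTB

open Filter
open scoped symmDiff

/-! ### Membership of algebras in a subvariety -/

/-- An algebra `B` lies in every subvariety containing `A` as soon as there is a subalgebra of
`A × B` that is the graph of a partial function from `A` onto `B`. -/
theorem Subvariety.mem_of_rel (V : Subvariety) {A B : KTBAlg} (hA : A ∈ V.carrier)
    (R : A → B → Prop)
    (hsup : ∀ x x' y y', R x y → R x' y' → R (x ⊔ x') (y ⊔ y'))
    (hcompl : ∀ x y, R x y → R xᶜ yᶜ)
    (hbot : R ⊥ ⊥)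
    (hdia : ∀ x y, R x y → R (dia x) (dia y))
    (hfun : ∀ x y y', R x y → R x y' → y = y')
    (hsurj : ∀ y, ∃ x, R x y) : B ∈ V.carrier := by
  have hinf : ∀ x x' y y', R x y → R x' y' → R (x ⊓ x') (y ⊓ y') := by
    intro x x' y y' h h'
    have := hcompl _ _ (hsup _ _ _ _ (hcompl _ _ h) (hcompl _ _ h'))
    simpa only [compl_sup, compl_compl] using this
  have htop : R ⊤ ⊤ := by simpa only [compl_bot] using hcompl _ _ hbot
  let S : KTBSubalgebra A :=
    { carrier := {x | ∃ y, R x y}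
      supClosed' := fun _ ⟨_, hy⟩ _ ⟨_, hy'⟩ => ⟨_, hsup _ _ _ _ hy hy'⟩
      infClosed' := fun _ ⟨_, hy⟩ _ ⟨_, hy'⟩ => ⟨_, hinf _ _ _ _ hy hy'⟩
      compl_mem' := fun ⟨_, hy⟩ => ⟨_, hcompl _ _ hy⟩
      bot_mem' := ⟨_, hbot⟩
      dia_mem' := fun _ ⟨_, hy⟩ => ⟨_, hdia _ _ hy⟩ }
  have hS : ∀ x : S.toAlg, ∃ y, R x.1 y := fun x => x.2
  choose φ hφ using hS
  let f : KTBHom S.toAlg B :=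
    { toFun := φ
      map_sup' := fun x x' => hfun _ _ _ (hφ _) (hsup _ _ _ _ (hφ x) (hφ x'))
      map_inf' := fun x x' => hfun _ _ _ (hφ _) (hinf _ _ _ _ (hφ x) (hφ x'))
      map_top' := hfun _ _ _ (hφ _) htop
      map_bot' := hfun _ _ _ (hφ _) hbot
      map_dia' := fun x => hfun _ _ _ (hφ _) (hdia _ _ (hφ x)) }
  refine V.hom_closed f (fun y => ?_) (V.sub_closed S hA)
  obtain ⟨x, hx⟩ := hsurj y
  exact ⟨⟨x, y, hx⟩, hfun _ _ _ (hφ _) hx⟩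

/-- A subvariety contains every algebra that embeds into one of its members. -/
theorem Subvariety.mem_of_injective (V : Subvariety) {A B : KTBAlg} (hB : B ∈ V.carrier)
    (h : A → B) (hinj : Function.Injective h)
    (hsup : ∀ x y, h (x ⊔ y) = h x ⊔ h y) (hcompl : ∀ x, h xᶜ = (h x)ᶜ) (hbot : h ⊥ = ⊥)
    (hdia : ∀ x, h (dia x) = dia (h x)) : A ∈ V.carrier :=
  V.mem_of_rel hB (fun y x => h x = y)
    (by rintro _ _ x x' rfl rfl; exact hsup x x')
    (by rintro _ x rfl; exact hcompl x)
    hbot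
    (by rintro _ x rfl; exact hdia x)
    (fun _ _ _ e e' => hinj (e.trans e'.symm))
    (fun x => ⟨h x, rfl⟩)

theorem mem_Var_self (A : KTBAlg) : A ∈ (Var {A}).carrier :=
  (Var_le_iff {A} _).1 le_rfl rfl

theorem Var_singleton_le_iff {A : KTBAlg} {V : Subvariety} :
    Var {A} ≤ V ↔ A ∈ V.carrier := by
  rw [Var_le_iff, Set.singleton_subset_iff]

/-! ### Unary terms -/

/-- Terms in one variable in the language of KTB-algebras. -/
inductive UTerm : Type
  | var
  | compl (t : UTerm)
  | inf (s t : UTerm)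
  | dia (t : UTerm)

/-- The unary operation that a term defines on a KTB-algebra. -/
def UTerm.eval {A : KTBAlg} (x : A) : UTerm → A
  | .var => x
  | .compl t => (t.eval x)ᶜ
  | .inf s t => s.eval x ⊓ t.eval x
  | .dia t => KTB.dia (t.eval x)

theorem UTerm.coe_eval {A : KTBAlg} {S : KTBSubalgebra A} (x : S.toAlg) (t : UTerm) :
    (t.eval x).1 = t.eval (A := A) x.1 := by
  induction t with
  | var => rfl
  | compl t ih => exact congrArg (fun y : A => yᶜ) ih
  | inf s t ihs iht => exact congrArg₂ (fun y z : A => y ⊓ z) ihs iht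
  | dia t ih => exact congrArg (fun y : A => KTB.dia y) ih

theorem UTerm.eval_apply {I : Type} {B : I → KTBAlg} (x : prod B) (i : I) (t : UTerm) :
    t.eval x i = t.eval (A := B i) (x i) := by
  induction t with
  | var => rfl
  | compl t ih => exact congrArg (fun y : B i => yᶜ) ih
  | inf s t ihs iht => exact congrArg₂ (fun y z : B i => y ⊓ z) ihs iht
  | dia t ih => exact congrArg (fun y : B i => KTB.dia y) ih

/-! ### Iterates of the operator -/

theorem dia_bot {A : KTBAlg} : dia (⊥ : A) = ⊥ := KTBAlgebra.dia_bot

theorem iterate_dia_bot {A : KTBAlg} (k : ℕ) : dia^[k] (⊥ : A) = ⊥ :=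
  Function.iterate_fixed dia_bot k

theorem KTBHom.map_iterate_dia {A B : KTBAlg} (f : KTBHom A B) (k : ℕ) (x : A) :
    f.toFun (dia^[k] x) = dia^[k] (f.toFun x) :=
  (Function.Semiconj.iterate_right (f := f.toFun) f.map_dia' k) x

theorem coe_iterate_dia {A : KTBAlg} {S : KTBSubalgebra A} (k : ℕ) (x : S.toAlg) :
    (dia^[k] x).1 = dia^[k] (x.1 : A) :=
  (Function.Semiconj.iterate_right (f := fun x : S.toAlg => (x.1 : A)) (fun _ => rfl) k) x

theorem iterate_dia_apply {I : Type} {B : I → KTBAlg} (k : ℕ) (x : prod B) (i : I) :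
    (dia^[k] x) i = dia^[k] (x i : B i) :=
  (Function.Semiconj.iterate_right (f := fun x : prod B => x i) (fun _ => rfl) k) x

/-! ### Subvarieties omitting the generating algebra -/

/-- Let `dia^[k]` send every nonzero element of `D` to `⊤`. If `A` is a homomorphic image of a
subalgebra `S` of a power of `D`, then every element of `S` with nonzero image is nonzero almost
everywhere for some ultrafilter on the index set through which the homomorphism factors. -/
theorem exists_compatible_ultrafilter {D A : KTBAlg} {k : ℕ}
    (hk : ∀ x : D, x ≠ ⊥ → dia^[k] x = ⊤) {I : Type}
    {S : KTBSubalgebra (prod fun _ : I => D)} (f : KTBHom S.toAlg A) {e : S.toAlg}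
    (he : f.toFun e ≠ ⊥) :
    ∃ 𝓕 : Ultrafilter I, (∀ s : S.toAlg, f.toFun s = ⊥ → ∀ᶠ i in 𝓕, s.1 i = (⊥ : D)) ∧
      ∀ᶠ i in 𝓕, e.1 i ≠ (⊥ : D) := by
  let F₀ : Filter I :=
    { sets := {U | ∃ s : S.toAlg, f.toFun s = ⊥ ∧
        ∀ i, s.1 i = (⊥ : D) → e.1 i ≠ (⊥ : D) → i ∈ U}
      univ_sets := ⟨⊥, f.map_bot', fun _ _ _ => trivial⟩
      sets_of_superset := fun ⟨s, hs, h⟩ hU => ⟨s, hs, fun i h₁ h₂ => hU (h i h₁ h₂)⟩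
      inter_sets := fun ⟨s, hs, h⟩ ⟨s', hs', h'⟩ => by
        refine ⟨s ⊔ s', (f.map_sup' s s').trans ?_, fun i h₁ h₂ => ?_⟩
        · exact (congrArg₂ (· ⊔ ·) hs hs').trans (bot_sup_eq _)
        · have h₃ : (s.1 i : D) ⊔ s'.1 i = ⊥ := h₁
          rw [sup_eq_bot_iff] at h₃
          exact ⟨h i h₃.1 h₂, h' i h₃.2 h₂⟩ }
  have : F₀.NeBot := by
    refine ⟨fun h0 => he ?_⟩
    obtain ⟨s, hs, h⟩ : ∅ ∈ F₀ := h0 ▸ mem_bot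
    -- the support of `e` is contained in that of `s`, so `e` lies below `dia^[k] s`
    have hle : e ≤ dia^[k] s := by
      intro i
      rw [coe_iterate_dia, iterate_dia_apply]
      by_cases hi : s.1 i = (⊥ : D)
      · have : e.1 i = (⊥ : D) := by
          by_contra hne
          exact h i hi hne
        rw [this]
        exact bot_le
      · rw [hk _ hi]
        exact le_top
    have h1 : f.toFun e ≤ f.toFun (dia^[k] s) := OrderHomClass.mono f.toBoundedLatticeHom hle
    rw [f.map_iterate_dia, hs, iterate_dia_bot] at h1
    exact le_bot_iff.1 h1
  refine ⟨Ultrafilter.of F₀, fun s hs => ?_, ?_⟩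
  · exact Ultrafilter.of_le F₀ ⟨s, hs, fun i h _ => h⟩
  · exact Ultrafilter.of_le F₀ ⟨⊥, f.map_bot', fun i _ h => h⟩

/-- If the homomorphism `f` from a subalgebra `S` of a power of `D` factors through the ultrafilter
`𝓕`, and `S` has a member equal almost everywhere to an element that generates `D`, then `D` lies in
every subvariety containing the image of `f`: it is a homomorphic image of a subalgebra. -/
theorem Subvariety.mem_of_eventually_eq_generator (V : Subvariety) {D A : KTBAlg}
    (hA : A ∈ V.carrier) {d : D}
    (hd : ∀ T : KTBSubalgebra D, d ∈ T.carrier → ∀ v, v ∈ T.carrier) {I : Type}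
    {S : KTBSubalgebra (prod fun _ : I => D)} (f : KTBHom S.toAlg A) (𝓕 : Ultrafilter I)
    (h𝓕 : ∀ s : S.toAlg, f.toFun s = ⊥ → ∀ᶠ i in 𝓕, s.1 i = (⊥ : D))
    {s : S.toAlg} (hs : ∀ᶠ i in 𝓕, s.1 i = d) : D ∈ V.carrier := by
  have hsup : ∀ (s s' : S.toAlg) (v v' : D), (∀ᶠ i in 𝓕, s.1 i = v) →
      (∀ᶠ i in 𝓕, s'.1 i = v') → ∀ᶠ i in 𝓕, (s ⊔ s').1 i = v ⊔ v' := by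
    intro s s' v v' h h'
    filter_upwards [h, h'] with i hi hi'
    exact congrArg₂ (fun x y : D => x ⊔ y) hi hi'
  have hcompl : ∀ (s : S.toAlg) (v : D), (∀ᶠ i in 𝓕, s.1 i = v) →
      ∀ᶠ i in 𝓕, (sᶜ).1 i = vᶜ := by
    intro s v h
    filter_upwards [h] with i hi
    exact congrArg (fun x : D => xᶜ) hi
  have hdia : ∀ (s : S.toAlg) (v : D), (∀ᶠ i in 𝓕, s.1 i = v) →
      ∀ᶠ i in 𝓕, (dia s).1 i = dia v := by
    intro s v h
    filter_upwards [h] with i hi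
    exact congrArg (fun x : D => dia x) hi
  have hinf : ∀ (s s' : S.toAlg) (v v' : D), (∀ᶠ i in 𝓕, s.1 i = v) →
      (∀ᶠ i in 𝓕, s'.1 i = v') → ∀ᶠ i in 𝓕, (s ⊓ s').1 i = v ⊓ v' := by
    intro s s' v v' h h'
    filter_upwards [h, h'] with i hi hi'
    exact congrArg₂ (fun x y : D => x ⊓ y) hi hi'
  have hbot : ∀ᶠ i in 𝓕, (⊥ : S.toAlg).1 i = (⊥ : D) := Eventually.of_forall fun _ => rfl
  let T : KTBSubalgebra D :=
    { carrier := {v | ∃ s : S.toAlg, ∀ᶠ i in 𝓕, s.1 i = v}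
      supClosed' := fun _ ⟨_, h⟩ _ ⟨_, h'⟩ => ⟨_, hsup _ _ _ _ h h'⟩
      infClosed' := fun _ ⟨_, h⟩ _ ⟨_, h'⟩ => ⟨_, hinf _ _ _ _ h h'⟩
      compl_mem' := fun ⟨_, h⟩ => ⟨_, hcompl _ _ h⟩
      bot_mem' := ⟨_, hbot⟩
      dia_mem' := fun _ ⟨_, h⟩ => ⟨_, hdia _ _ h⟩ }
  refine V.mem_of_rel hA (fun α v => ∃ s : S.toAlg, f.toFun s = α ∧ ∀ᶠ i in 𝓕, s.1 i = v)
    ?_ ?_ ?_ ?_ ?_ ?_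
  · rintro _ _ v v' ⟨s, rfl, h⟩ ⟨s', rfl, h'⟩
    exact ⟨s ⊔ s', f.map_sup' s s', hsup _ _ _ _ h h'⟩
  · rintro _ v ⟨s, rfl, h⟩
    exact ⟨sᶜ, map_compl' f.toBoundedLatticeHom s, hcompl _ _ h⟩
  · exact ⟨⊥, f.map_bot', hbot⟩
  · rintro _ v ⟨s, rfl, h⟩
    exact ⟨dia s, f.map_dia' s, hdia _ _ h⟩
  · rintro _ v v' ⟨s, rfl, h⟩ ⟨s', e, h'⟩
    have h0 : f.toFun (s ∆ s') = ⊥ := by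
      refine (map_symmDiff' f.toBoundedLatticeHom s s').trans ?_
      exact symmDiff_eq_bot.2 e.symm
    obtain ⟨i, hi, hi', hi0⟩ := (h.and (h'.and (h𝓕 _ h0))).exists
    have : (s.1 i : D) ∆ s'.1 i = ⊥ := hi0
    rw [hi, hi'] at this
    exact symmDiff_eq_bot.1 this
  · intro v
    obtain ⟨s', h'⟩ := hd T ⟨s, hs⟩ v
    exact ⟨_, s', rfl, h'⟩

/-- Suppose that `d` generates `D`, that `dia^[k]` sends every nonzero element of `D` to `⊤`, and
that each `x : D` from which none of finitely many terms produces `d` is either `⊥` or satisfies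
`dia x = ⊤` and contains one of the finitely many points `g`. Then every subvariety of `Var {D}`
that omits `D` lies in the variety generated by a complete graph on these points. -/
theorem le_Var_complete_of_notMem {D : KTBAlg} {J : Type} [Finite J] {d : D}
    (hd : ∀ T : KTBSubalgebra D, d ∈ T.carrier → ∀ v, v ∈ T.carrier) {k : ℕ}
    (hk : ∀ x : D, x ≠ ⊥ → dia^[k] x = ⊤) (g : BoundedLatticeHom D (Set J))
    {τ : Set UTerm} (hτ : τ.Finite)
    (h : ∀ x : D, x = ⊥ ∨ (dia x = ⊤ ∧ (g x).Nonempty) ∨ ∃ t ∈ τ, t.eval x = d)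
    {V : Subvariety} (hV : V ≤ Var {D}) (hDV : D ∉ V.carrier) :
    V ≤ Var {Cm (⊤ : SimpleGraph J)} := by
  intro A hA
  obtain ⟨I, B, S, f, hB, hf⟩ := hV hA
  obtain rfl : B = fun _ => D := funext hB
  let U := {𝓕 : Ultrafilter I // ∀ s : S.toAlg, f.toFun s = ⊥ → ∀ᶠ i in 𝓕, s.1 i = (⊥ : D)}
  -- along a compatible ultrafilter no term produces `d`, since `D` would then lie in `V`
  have good : ∀ (𝓕 : U) (s : S.toAlg), (∀ᶠ i in 𝓕.1, s.1 i = (⊥ : D)) ∨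
      ∀ᶠ i in 𝓕.1, dia (s.1 i : D) = ⊤ ∧ (g (s.1 i)).Nonempty := by
    intro 𝓕 s
    have h1 : ∀ᶠ i in 𝓕.1, s.1 i = (⊥ : D) ∨ (dia (s.1 i : D) = ⊤ ∧ (g (s.1 i)).Nonempty) ∨
        ∃ t ∈ τ, t.eval (s.1 i : D) = d := Eventually.of_forall fun i => h (s.1 i)
    rw [Ultrafilter.eventually_or, Ultrafilter.eventually_or,
      Ultrafilter.eventually_exists_mem_iff hτ] at h1
    rcases h1 with h1 | h1 | ⟨t, -, ht⟩
    · exact Or.inl h1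
    · exact Or.inr h1
    · refine absurd (V.mem_of_eventually_eq_generator hA hd f 𝓕.1 𝓕.2 (s := t.eval s) ?_) hDV
      filter_upwards [ht] with i hi
      rw [UTerm.coe_eval, UTerm.eval_apply]
      exact hi
  let lim : S.toAlg → U → Set J := fun s 𝓕 => {j | ∀ᶠ i in 𝓕.1, j ∈ g (s.1 i)}
  have lim_sup : ∀ s s', lim (s ⊔ s') = fun 𝓕 => lim s 𝓕 ∪ lim s' 𝓕 := by
    intro s s'
    ext 𝓕 j
    refine Iff.trans ?_ Ultrafilter.eventually_or
    refine eventually_congr (Eventually.of_forall fun i => ?_)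
    exact Set.ext_iff.1 (map_sup g (s.1 i) (s'.1 i)) j
  have lim_compl : ∀ s, lim sᶜ = fun 𝓕 => (lim s 𝓕)ᶜ := by
    intro s
    ext 𝓕 j
    refine Iff.trans ?_ Ultrafilter.eventually_not
    refine eventually_congr (Eventually.of_forall fun i => ?_)
    exact Set.ext_iff.1 (map_compl' g (s.1 i)) j
  have lim_bot' : ∀ (𝓕 : U) (s : S.toAlg), (∀ᶠ i in 𝓕.1, s.1 i = (⊥ : D)) → lim s 𝓕 = ∅ := by
    intro 𝓕 s hs
    ext j
    simp only [Set.mem_empty_iff_false, iff_false]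
    intro hj
    obtain ⟨i, hi, hi'⟩ := (hs.and hj).exists
    have e : g (s.1 i) = ⊥ := (congrArg g hi).trans (map_bot g)
    rw [e] at hi'
    exact hi'
  have lim_nonempty : ∀ (𝓕 : U) (s : S.toAlg), (∀ᶠ i in 𝓕.1, (g (s.1 i)).Nonempty) →
      (lim s 𝓕).Nonempty := fun 𝓕 s hs => Ultrafilter.eventually_exists_iff.1 hs
  have lim_dia : ∀ s, lim (dia s) = dia (A := prod fun _ : U => Cm (⊤ : SimpleGraph J)) (lim s) := by
    intro s
    funext 𝓕
    change _ = dia (A := Cm (⊤ : SimpleGraph J)) (lim s 𝓕)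
    rcases good 𝓕 s with hs | hs
    · rw [lim_bot' 𝓕 s hs, lim_bot' 𝓕 (dia s)]
      · exact (dia_bot (A := Cm (⊤ : SimpleGraph J))).symm
      · filter_upwards [hs] with i hi
        exact (congrArg (fun x : D => dia x) hi).trans dia_bot
    · obtain ⟨j₀, hj₀⟩ := lim_nonempty 𝓕 s (hs.mono fun _ => And.right)
      refine Set.ext fun j => ?_
      refine iff_of_true ?_ ⟨j₀, hj₀, or_iff_not_imp_left.2 id⟩
      filter_upwards [hs] with i hi
      have e : g ((dia s).1 i) = ⊤ := (congrArg g hi.1).trans (map_top g)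
      rw [e]
      trivial
  refine (Var _).mem_of_rel ((Var _).prod_closed (fun _ : U => Cm (⊤ : SimpleGraph J))
    fun _ => mem_Var_self _) (fun p α => ∃ s : S.toAlg, f.toFun s = α ∧ p = lim s) ?_ ?_ ?_ ?_ ?_ ?_
  · rintro _ _ _ _ ⟨s, rfl, rfl⟩ ⟨s', rfl, rfl⟩
    exact ⟨s ⊔ s', f.map_sup' s s', (lim_sup s s').symm⟩
  · rintro _ _ ⟨s, rfl, rfl⟩
    exact ⟨sᶜ, map_compl' f.toBoundedLatticeHom s, (lim_compl s).symm⟩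
  · refine ⟨⊥, f.map_bot', funext fun 𝓕 => ?_⟩
    exact (lim_bot' 𝓕 ⊥ (Eventually.of_forall fun _ => rfl)).symm
  · rintro _ _ ⟨s, rfl, rfl⟩
    exact ⟨dia s, f.map_dia' s, (lim_dia s).symm⟩
  · rintro _ _ _ ⟨s, rfl, rfl⟩ ⟨s', rfl, e⟩
    by_contra hne
    have he : f.toFun (s ∆ s') ≠ ⊥ := by
      intro h0
      exact hne (symmDiff_eq_bot.1 ((map_symmDiff' f.toBoundedLatticeHom s s').symm.trans h0))
    obtain ⟨𝓕, h𝓕, hs⟩ := exists_compatible_ultrafilter hk f he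
    rcases good ⟨𝓕, h𝓕⟩ (s ∆ s') with h1 | h1
    · obtain ⟨i, hi, hi'⟩ := (hs.and h1).exists
      exact hi hi'
    · obtain ⟨j, hj⟩ := lim_nonempty ⟨𝓕, h𝓕⟩ _ (h1.mono fun _ => And.right)
      have hj' : ∀ᶠ i in 𝓕, ¬(j ∈ g (s.1 i) ↔ j ∈ g (s'.1 i)) := by
        filter_upwards [hj] with i hi
        have e1 : g ((s ∆ s').1 i) = g (s.1 i) ∆ g (s'.1 i) := map_symmDiff' g (s.1 i) (s'.1 i)
        rw [e1, Set.mem_symmDiff] at hi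
        tauto
      have e2 : (∀ᶠ i in 𝓕, j ∈ g (s.1 i)) ↔ ∀ᶠ i in 𝓕, j ∈ g (s'.1 i) :=
        Set.ext_iff.1 (congrFun e ⟨𝓕, h𝓕⟩) j
      by_cases h2 : ∀ᶠ i in 𝓕, j ∈ g (s.1 i)
      · obtain ⟨i, hi, hi', hi''⟩ := (hj'.and (h2.and (e2.1 h2))).exists
        exact hi (iff_of_true hi' hi'')
      · have h3 := Ultrafilter.eventually_not.2 h2
        have h4 := Ultrafilter.eventually_not.2 (mt e2.2 h2)
        obtain ⟨i, hi, hi', hi''⟩ := (hj'.and (h3.and h4)).exists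
        exact hi (iff_of_false hi' hi'')
  · intro α
    obtain ⟨s, hs⟩ := hf α
    exact ⟨_, s, hs, rfl⟩

/-! ### Equational classes and the bottom of the lattice -/

theorem UTerm.eval_map {A B : KTBAlg} (f : KTBHom A B) (x : A) (t : UTerm) :
    f.toFun (t.eval x) = t.eval (f.toFun x) := by
  induction t with
  | var => rfl
  | compl t ih =>
    exact (map_compl' f.toBoundedLatticeHom _).trans (congrArg (fun y : B => yᶜ) ih)
  | inf s t ihs iht => exact (f.map_inf' _ _).trans (congrArg₂ (fun y z : B => y ⊓ z) ihs iht)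
  | dia t ih => exact (f.map_dia' _).trans (congrArg (fun y : B => KTB.dia y) ih)

/-- The subvariety axiomatised by one equation between unary terms. -/
def Subvariety.ofEq (s t : UTerm) : Subvariety where
  carrier := {A | ∀ x : A, s.eval x = t.eval x}
  hom_closed := by
    intro A B f hf hA y
    obtain ⟨x, rfl⟩ := hf y
    rw [← UTerm.eval_map, ← UTerm.eval_map, hA x]
  sub_closed := by
    intro A S hA x
    refine Subtype.ext ?_
    rw [UTerm.coe_eval, UTerm.coe_eval]
    exact hA x.1
  prod_closed := by
    intro I A hA x
    funext i
    rw [UTerm.eval_apply, UTerm.eval_apply]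
    exact hA i (x i)

theorem notMem_Var_of_eval_ne {A B : KTBAlg} (s t : UTerm) (hA : ∀ x : A, s.eval x = t.eval x)
    {y : B} (hy : s.eval y ≠ t.eval y) : B ∉ (Var {A}).carrier := by
  intro hB
  have h : Var {A} ≤ Subvariety.ofEq s t := Var_singleton_le_iff.2 hA
  exact hy (h hB y)

theorem dia_top {A : KTBAlg} : dia (⊤ : A) = ⊤ := top_le_iff.1 (KTBAlgebra.le_dia (A := A) ⊤)

theorem dia_complete_of_nonempty {J : Type} {X : Set J} (hX : X.Nonempty) :
    dia (A := Cm (⊤ : SimpleGraph J)) X = (Set.univ : Set J) := by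
  obtain ⟨j, hj⟩ := hX
  exact Set.eq_univ_of_forall fun i => ⟨j, hj, or_iff_not_imp_left.2 id⟩

/-- The complex algebra of the one-vertex graph is the two-element algebra, which embeds into every
nontrivial algebra. -/
theorem Var_complete_one_le {V : Subvariety} (hV : V ≠ ⊥) :
    Var {Cm (⊤ : SimpleGraph Unit)} ≤ V := by
  obtain ⟨A, hA, hne⟩ : ∃ A ∈ V.carrier, ¬Subsingleton A := by
    by_contra! h
    exact hV (le_bot_iff.1 fun A hA => h A hA)
  rw [not_subsingleton_iff_nontrivial] at hne
  have hcases : ∀ X : Set Unit, X = ∅ ∨ X = Set.univ := by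
    intro X
    rcases X.eq_empty_or_nonempty with h | h
    · exact Or.inl h
    · exact Or.inr (Subsingleton.eq_univ_of_nonempty h)
  classical
  let φ : Set Unit → A := fun X => if () ∈ X then ⊤ else ⊥
  have φ0 : φ ∅ = ⊥ := if_neg id
  have φ1 : φ Set.univ = ⊤ := if_pos trivial
  refine Var_singleton_le_iff.2 (V.mem_of_injective hA φ ?_ ?_ ?_ φ0 ?_)
  · intro X Y h
    rcases hcases X with rfl | rfl <;> rcases hcases Y with rfl | rfl
    · rfl
    · rw [φ0, φ1] at h
      exact absurd h bot_ne_top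
    · rw [φ0, φ1] at h
      exact absurd h top_ne_bot
    · rfl
  · intro X Y
    change φ ((X : Set Unit) ∪ Y) = φ X ⊔ φ Y
    rcases hcases X with rfl | rfl <;> rcases hcases Y with rfl | rfl <;> simp [φ]
  · intro X
    change φ ((X : Set Unit)ᶜ) = (φ X)ᶜ
    rcases hcases X with rfl | rfl <;> simp [φ]
  · intro X
    rcases hcases X with rfl | rfl
    · have e : dia (A := Cm (⊤ : SimpleGraph Unit)) (∅ : Set Unit) = (∅ : Set Unit) :=
        dia_bot (A := Cm (⊤ : SimpleGraph Unit))
      rw [e, φ0, dia_bot]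
    · rw [dia_complete_of_nonempty Set.univ_nonempty, φ1, dia_top]

theorem bot_lt_Var_complete_one : ⊥ < Var {Cm (⊤ : SimpleGraph Unit)} := by
  refine bot_lt_iff_ne_bot.2 fun h => ?_
  have h0 := mem_Var_self (Cm (⊤ : SimpleGraph Unit))
  rw [h] at h0
  have h1 : Subsingleton (Set Unit) := h0
  exact Set.empty_ne_univ (h1.elim ∅ Set.univ)

/-! ### Subvarieties of the variety of the complete graph on two vertices -/

theorem complete_two_notMem :
    Cm (⊤ : SimpleGraph (Fin 2)) ∉ (Var {Cm (⊤ : SimpleGraph Unit)}).carrier := by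
  refine notMem_Var_of_eval_ne (.dia .var) .var ?_ (y := ({0} : Set (Fin 2))) ?_
  · intro X
    rcases (show Set Unit from X).eq_empty_or_nonempty with rfl | h
    · exact dia_bot (A := Cm (⊤ : SimpleGraph Unit))
    · exact (dia_complete_of_nonempty h).trans (Subsingleton.eq_univ_of_nonempty h).symm
  · intro h
    have h1 : (Set.univ : Set (Fin 2)) = {0} :=
      (dia_complete_of_nonempty (X := ({0} : Set (Fin 2))) ⟨0, rfl⟩).symm.trans h
    have h2 : (1 : Fin 2) ∈ ({0} : Set (Fin 2)) := h1 ▸ Set.mem_univ 1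
    simp at h2

theorem le_Var_complete_one {V : Subvariety} (hV : V ≤ Var {Cm (⊤ : SimpleGraph (Fin 2))})
    (h2 : Cm (⊤ : SimpleGraph (Fin 2)) ∉ V.carrier) : V ≤ Var {Cm (⊤ : SimpleGraph Unit)} := by
  let g : BoundedLatticeHom (Cm (⊤ : SimpleGraph (Fin 2))) (Set Unit) :=
    { toFun := fun X => {_j | (0 : Fin 2) ∈ (show Set (Fin 2) from X)}
      map_sup' := fun _ _ => rfl
      map_inf' := fun _ _ => rfl
      map_top' := rfl
      map_bot' := rfl }
  have hcases : ∀ X : Set (Fin 2), X = ∅ ∨ X = {0} ∨ Xᶜ = {0} ∨ X = Set.univ := by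
    intro X
    by_cases h0 : (0 : Fin 2) ∈ X <;> by_cases h1 : (1 : Fin 2) ∈ X <;>
      simp [Set.ext_iff, Fin.forall_fin_two, h0, h1]
  refine le_Var_complete_of_notMem (d := ({0} : Set (Fin 2))) ?_ (k := 1) ?_ g
    (τ := {.var, .compl .var}) (Set.toFinite _) ?_ hV h2
  · intro T hd X
    rcases hcases X with h | h | h | h
    · exact Set.mem_of_eq_of_mem h T.bot_mem'
    · exact Set.mem_of_eq_of_mem h hd
    · exact Set.mem_of_eq_of_mem (compl_eq_comm.1 h).symm (T.compl_mem' hd)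
    · exact Set.mem_of_eq_of_mem (h.trans Set.compl_empty.symm) (T.compl_mem' T.bot_mem')
  · intro X hX
    exact dia_complete_of_nonempty (Set.nonempty_iff_ne_empty.2 hX)
  · intro X
    rcases hcases X with h | h | h | h
    · exact Or.inl h
    · exact Or.inr (Or.inr ⟨.var, Or.inl rfl, h⟩)
    · exact Or.inr (Or.inr ⟨.compl .var, Or.inr rfl, h⟩)
    · refine Or.inr (Or.inl ⟨?_, (), ?_⟩)
      · exact dia_complete_of_nonempty (h ▸ Set.univ_nonempty)
      · change (0 : Fin 2) ∈ (show Set (Fin 2) from X)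
        exact h ▸ Set.mem_univ 0

/-! ### Covers and heights -/

theorem covBy_and_height_eq_add_one {P : Type*} [PartialOrder P] {v w : P} (hlt : v < w)
    (h : ∀ x < w, x ≤ v) : v ⋖ w ∧ Order.height w = Order.height v + 1 := by
  refine ⟨⟨hlt, fun x hx hxw => hx.not_ge (h x hxw)⟩, ?_⟩
  rw [Order.height_eq_iSup_lt_height]
  refine le_antisymm (iSup₂_le fun x hx => ?_) (le_iSup₂_of_le v hlt le_rfl)
  gcongr
  exact h x hx

/-! ### Neighbourhoods in `F N` -/

/-- The operator of `Cm (F N)`, as a map on sets of vertices. -/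
def nbhd (N : Set ℕ) (X : Set W) : Set W := {x | ∃ y ∈ X, x = y ∨ (F N).Adj x y}

section

variable {N : Set ℕ} {X Y : Set W}

theorem mem_nbhd_iff {x : W} :
    x ∈ nbhd N X ↔ x ∈ X ∨ ∃ y ∈ X, x ≠ y ∧ (Edge N x y ∨ Edge N y x) := by
  simp only [nbhd, F, SimpleGraph.fromRel_adj]
  constructor
  · rintro ⟨y, hy, rfl | h⟩
    · exact Or.inl hy
    · exact Or.inr ⟨y, hy, h⟩
  · rintro (h | ⟨y, hy, h⟩)
    · exact ⟨x, h, Or.inl rfl⟩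
    · exact ⟨y, hy, Or.inr h⟩

theorem subset_nbhd : X ⊆ nbhd N X := fun _ h => mem_nbhd_iff.2 (Or.inl h)

theorem d_mem_nbhd : W.d ∈ nbhd N X ↔ W.d ∈ X ∨ W.c1 ∈ X := by
  rw [mem_nbhd_iff]
  constructor
  · rintro (h | ⟨y, hy, -, h | h⟩)
    · exact Or.inl h
    · cases h
    · cases h; exact Or.inr hy
  · rintro (h | h)
    · exact Or.inl h
    · exact Or.inr ⟨_, h, by simp, Or.inr .c1_d⟩

theorem c1_mem_nbhd : W.c1 ∈ nbhd N X ↔ W.c1 ∈ X ∨ W.d ∈ X ∨ W.b1 ∈ X := by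
  rw [mem_nbhd_iff]
  constructor
  · rintro (h | ⟨y, hy, -, h | h⟩)
    · exact Or.inl h
    · cases h; exact Or.inr (Or.inl hy)
    · cases h; exact Or.inr (Or.inr hy)
  · rintro (h | h | h)
    · exact Or.inl h
    · exact Or.inr ⟨_, h, by simp, Or.inl .c1_d⟩
    · exact Or.inr ⟨_, h, by simp, Or.inr .b1_c1⟩

theorem b1_mem_nbhd : W.b1 ∈ nbhd N X ↔ W.b1 ∈ X ∨ W.c1 ∈ X ∨ W.a ∈ X := by
  rw [mem_nbhd_iff]
  constructor
  · rintro (h | ⟨y, hy, -, h | h⟩)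
    · exact Or.inl h
    · cases h; exact Or.inr (Or.inl hy)
    · cases h; exact Or.inr (Or.inr hy)
  · rintro (h | h | h)
    · exact Or.inl h
    · exact Or.inr ⟨_, h, by simp, Or.inl .b1_c1⟩
    · exact Or.inr ⟨_, h, by simp, Or.inr .a_b1⟩

theorem b2_mem_nbhd : W.b2 ∈ nbhd N X ↔ W.b2 ∈ X ∨ W.c2 ∈ X ∨ W.a ∈ X := by
  rw [mem_nbhd_iff]
  constructor
  · rintro (h | ⟨y, hy, -, h | h⟩)
    · exact Or.inl h
    · cases h; exact Or.inr (Or.inl hy)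
    · cases h; exact Or.inr (Or.inr hy)
  · rintro (h | h | h)
    · exact Or.inl h
    · exact Or.inr ⟨_, h, by simp, Or.inl .b2_c2⟩
    · exact Or.inr ⟨_, h, by simp, Or.inr .a_b2⟩

theorem c2_mem_nbhd : W.c2 ∈ nbhd N X ↔ W.c2 ∈ X ∨ W.b2 ∈ X := by
  rw [mem_nbhd_iff]
  constructor
  · rintro (h | ⟨y, hy, -, h | h⟩)
    · exact Or.inl h
    · cases h
    · cases h; exact Or.inr hy
  · rintro (h | h)
    · exact Or.inl h
    · exact Or.inr ⟨_, h, by simp, Or.inr .b2_c2⟩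

theorem b3_mem_nbhd : W.b3 ∈ nbhd N X ↔ W.b3 ∈ X ∨ W.a ∈ X := by
  rw [mem_nbhd_iff]
  constructor
  · rintro (h | ⟨y, hy, -, h | h⟩)
    · exact Or.inl h
    · cases h
    · cases h; exact Or.inr hy
  · rintro (h | h)
    · exact Or.inl h
    · exact Or.inr ⟨_, h, by simp, Or.inr .a_b3⟩

theorem a_mem_nbhd : W.a ∈ nbhd N X ↔
    W.a ∈ X ∨ W.b1 ∈ X ∨ W.b2 ∈ X ∨ W.b3 ∈ X ∨ ∃ i, W.l i ∈ X := by
  rw [mem_nbhd_iff]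
  constructor
  · rintro (h | ⟨y, hy, -, h | h⟩)
    · exact Or.inl h
    · cases h
      · exact Or.inr (Or.inl hy)
      · exact Or.inr (Or.inr (Or.inl hy))
      · exact Or.inr (Or.inr (Or.inr (Or.inl hy)))
      · exact Or.inr (Or.inr (Or.inr (Or.inr ⟨_, hy⟩)))
    · cases h
  · rintro (h | h | h | h | ⟨i, h⟩)
    · exact Or.inl h
    · exact Or.inr ⟨_, h, by simp, Or.inl .a_b1⟩
    · exact Or.inr ⟨_, h, by simp, Or.inl .a_b2⟩
    · exact Or.inr ⟨_, h, by simp, Or.inl .a_b3⟩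
    · exact Or.inr ⟨_, h, by simp, Or.inl (.a_l i)⟩

theorem l_mem_nbhd_of_a_mem (h : W.a ∈ X) (i : ℕ) : W.l i ∈ nbhd N X :=
  mem_nbhd_iff.2 (Or.inr ⟨_, h, by simp, Or.inr (.a_l i)⟩)

theorem l_mem_nbhd_of_u_mem {i : ℕ} (hi : i ≠ 0) (h : W.u i hi ∈ X) : W.l i ∈ nbhd N X :=
  mem_nbhd_iff.2 (Or.inr ⟨_, h, by simp, Or.inl (.l_u i hi)⟩)

theorem u_mem_nbhd_of_l_mem {i : ℕ} (hi : i ≠ 0) (h : W.l i ∈ X) : W.u i hi ∈ nbhd N X :=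
  mem_nbhd_iff.2 (Or.inr ⟨_, h, by simp, Or.inr (.l_u i hi)⟩)

theorem u_mem_nbhd {i : ℕ} {hi : i ≠ 0} (h : W.u i hi ∈ nbhd N X) :
    W.u i hi ∈ X ∨ ∃ j, W.l j ∈ X := by
  rw [mem_nbhd_iff] at h
  rcases h with h | ⟨y, hy, -, h | h⟩
  · exact Or.inl h
  · cases h
  · cases h <;> exact Or.inr ⟨_, hy⟩

/-- `d` is the only vertex at distance more than two from `a`. -/
theorem mem_nbhd_nbhd_of_a_mem (h : W.a ∈ X) {v : W} (hv : v ≠ .d) : v ∈ nbhd N (nbhd N X) := by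
  cases v with
  | a => exact subset_nbhd (subset_nbhd h)
  | b1 => exact subset_nbhd (b1_mem_nbhd.2 (by simp [h]))
  | b2 => exact subset_nbhd (b2_mem_nbhd.2 (by simp [h]))
  | b3 => exact subset_nbhd (b3_mem_nbhd.2 (by simp [h]))
  | c1 => exact c1_mem_nbhd.2 (by simp [b1_mem_nbhd, h])
  | c2 => exact c2_mem_nbhd.2 (by simp [b2_mem_nbhd, h])
  | d => exact absurd rfl hv
  | u i hi => exact u_mem_nbhd_of_l_mem hi (l_mem_nbhd_of_a_mem h i)
  | l i => exact subset_nbhd (l_mem_nbhd_of_a_mem h i)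

theorem compl_nbhd_nbhd_eq_of_a_mem (h : W.a ∈ X) (hd : W.d ∉ nbhd N (nbhd N X)) :
    (nbhd N (nbhd N X))ᶜ = {W.d} := by
  ext v
  rw [Set.mem_compl_iff, Set.mem_singleton_iff]
  constructor
  · intro hv
    by_contra hne
    exact hv (mem_nbhd_nbhd_of_a_mem h hne)
  · rintro rfl
    exact hd

/-- Every vertex is at distance at most three from `a`. -/
theorem a_mem_nbhd_three (h : X.Nonempty) : W.a ∈ nbhd N (nbhd N (nbhd N X)) := by
  obtain ⟨v, hv⟩ := h
  cases v with
  | u i hi =>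
    exact subset_nbhd (a_mem_nbhd.2 (Or.inr (Or.inr (Or.inr (Or.inr
      ⟨i, l_mem_nbhd_of_u_mem hi hv⟩)))))
  | l i =>
    exact subset_nbhd (subset_nbhd (a_mem_nbhd.2 (Or.inr (Or.inr (Or.inr (Or.inr ⟨i, hv⟩))))))
  | _ => simp [a_mem_nbhd, b1_mem_nbhd, b2_mem_nbhd, c1_mem_nbhd, c2_mem_nbhd, hv]

/-- The graph has diameter at most five. -/
theorem nbhd_five_eq_univ (h : X.Nonempty) :
    nbhd N (nbhd N (nbhd N (nbhd N (nbhd N X)))) = Set.univ := by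
  refine Set.eq_univ_of_forall fun v => ?_
  by_cases hv : v = .d
  · obtain ⟨w, hw⟩ := h
    subst hv
    cases w with
    | u i hi =>
      have := l_mem_nbhd_of_u_mem (N := N) hi hw
      simp only [d_mem_nbhd, c1_mem_nbhd, b1_mem_nbhd, a_mem_nbhd]
      have : ∃ i, W.l i ∈ nbhd N X := ⟨i, this⟩
      tauto
    | l i =>
      have : ∃ i, W.l i ∈ X := ⟨i, hw⟩
      simp only [d_mem_nbhd, c1_mem_nbhd, b1_mem_nbhd, a_mem_nbhd]
      tauto
    | _ => simp [d_mem_nbhd, a_mem_nbhd, b1_mem_nbhd, b2_mem_nbhd, c1_mem_nbhd, hw]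
  · exact mem_nbhd_nbhd_of_a_mem (a_mem_nbhd_three h) hv

/-- A nonempty set of vertices among `c2` and the `u i` is at distance five from `d` and at distance
at most four from every other vertex. -/
theorem compl_nbhd_four_eq (hX : X.Nonempty) (ha : W.a ∉ X) (hb1 : W.b1 ∉ X) (hb2 : W.b2 ∉ X)
    (hb3 : W.b3 ∉ X) (hc1 : W.c1 ∉ X) (hd : W.d ∉ X) (hl : ∀ i, W.l i ∉ X) :
    (nbhd N (nbhd N (nbhd N (nbhd N X))))ᶜ = {W.d} := by
  apply compl_nbhd_nbhd_eq_of_a_mem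
  · obtain ⟨v, hv⟩ := hX
    cases v with
    | c2 => simp [a_mem_nbhd, b2_mem_nbhd, hv]
    | u i hi =>
      exact a_mem_nbhd.2 (Or.inr (Or.inr (Or.inr (Or.inr ⟨i, l_mem_nbhd_of_u_mem hi hv⟩))))
    | l i => exact absurd hv (hl i)
    | _ => contradiction
  · simp [d_mem_nbhd, c1_mem_nbhd, b1_mem_nbhd, a_mem_nbhd, ha, hb1, hb2, hb3, hc1, hd, hl]

/-! ### Separated pairs of sets of vertices -/

/-- The case in which `a` separates the two sets: if both come within distance three of `d`, then
one of them stays at distance three from `c2`, since `b2` and `c2` are adjacent. -/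
theorem d_definable_of_a_notMem (hY : (nbhd N Y)ᶜ = X) (hX : (nbhd N X)ᶜ = Y)
    (haX : W.a ∉ X) (haY : W.a ∉ Y) :
    (nbhd N (nbhd N (nbhd N X)))ᶜ = {W.d} ∨ (nbhd N (nbhd N (nbhd N Y)))ᶜ = {W.d} ∨
      (nbhd N (nbhd N (nbhd N (nbhd N (nbhd N (nbhd N X))ᶜ))))ᶜ = {W.d} ∨
      (nbhd N (nbhd N (nbhd N (nbhd N (nbhd N (nbhd N Y))ᶜ))))ᶜ = {W.d} := by
  have hY' : ∀ v, v ∈ X ↔ v ∉ nbhd N Y := fun v => by rw [← hY, Set.mem_compl_iff]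
  have hX' : ∀ v, v ∈ Y ↔ v ∉ nbhd N X := fun v => by rw [← hX, Set.mem_compl_iff]
  have haX' : W.a ∈ nbhd N X := not_not.1 (mt (hX' _).2 haY)
  have haY' : W.a ∈ nbhd N Y := not_not.1 (mt (hY' _).2 haX)
  by_cases hdX : W.d ∈ nbhd N (nbhd N (nbhd N X))
  swap
  · exact Or.inl (compl_nbhd_nbhd_eq_of_a_mem haX' hdX)
  by_cases hdY : W.d ∈ nbhd N (nbhd N (nbhd N Y))
  swap
  · exact Or.inr (Or.inl (compl_nbhd_nbhd_eq_of_a_mem haY' hdY))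
  have key : ∀ Z : Set W, W.a ∉ Z → W.a ∈ nbhd N Z → W.d ∈ nbhd N (nbhd N (nbhd N Z)) →
      W.c2 ∉ nbhd N (nbhd N Z) →
      (nbhd N (nbhd N (nbhd N (nbhd N (nbhd N (nbhd N Z))ᶜ))))ᶜ = {W.d} := by
    intro Z haZ haZ' hdZ hc2
    have hd' : W.d ∈ nbhd N (nbhd N Z) ∧ W.c1 ∈ nbhd N (nbhd N Z) := by
      simp only [d_mem_nbhd, c1_mem_nbhd, b1_mem_nbhd] at hdZ ⊢
      tauto
    refine compl_nbhd_four_eq ⟨_, hc2⟩ ?_ ?_ ?_ ?_ ?_ ?_ ?_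
    · exact not_not.2 (subset_nbhd haZ')
    · exact not_not.2 (b1_mem_nbhd.2 (Or.inr (Or.inr haZ')))
    · exact not_not.2 (b2_mem_nbhd.2 (Or.inr (Or.inr haZ')))
    · exact not_not.2 (b3_mem_nbhd.2 (Or.inr haZ'))
    · exact not_not.2 hd'.2
    · exact not_not.2 hd'.1
    · exact fun i => not_not.2 (l_mem_nbhd_of_a_mem haZ' i)
  by_cases hcX : W.c2 ∈ nbhd N (nbhd N X)
  swap
  · exact Or.inr (Or.inr (Or.inl (key X haX haX' hdX hcX)))
  refine Or.inr (Or.inr (Or.inr (key Y haY haY' hdY fun hcY => ?_)))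
  have h1 := hX' .c2
  have h2 := hX' .b2
  simp only [c2_mem_nbhd, b2_mem_nbhd] at hcX hcY h1 h2
  tauto

/-- The case in which `a` lies in one of the two sets. Unless a shorter term produces `{d}`, the
other set contains `d` and `c2`, so that `c1` and `b2` lie in neither set. Then the vertices that are
neither such nor adjacent to such include `b3`, and all of them are at distance at least four from
`d`. -/
theorem d_definable_of_a_mem (hY : (nbhd N Y)ᶜ = X) (hX : (nbhd N X)ᶜ = Y)
    (ha : W.a ∈ X) (hne : Y.Nonempty) :
    (nbhd N (nbhd N X))ᶜ = {W.d} ∨ (nbhd N (nbhd N (nbhd N (nbhd N Y))))ᶜ = {W.d} ∨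
      (nbhd N (nbhd N (nbhd N (nbhd N (nbhd N (nbhd N (nbhd N Y)))ᶜ))))ᶜ = {W.d} ∨ Y = {W.d} ∨
      (nbhd N (nbhd N (nbhd N (nbhd N (Xᶜ ∩ Yᶜ))ᶜ)))ᶜ = {W.d} := by
  have hY' : ∀ v, v ∈ X ↔ v ∉ nbhd N Y := fun v => by rw [← hY, Set.mem_compl_iff]
  have hX' : ∀ v, v ∈ Y ↔ v ∉ nbhd N X := fun v => by rw [← hX, Set.mem_compl_iff]
  have haY : W.a ∉ Y := fun h => (hX' _).1 h (subset_nbhd ha)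
  have hb1 : W.b1 ∉ Y := fun h => (hX' _).1 h (b1_mem_nbhd.2 (Or.inr (Or.inr ha)))
  have hb2 : W.b2 ∉ Y := fun h => (hX' _).1 h (b2_mem_nbhd.2 (Or.inr (Or.inr ha)))
  have hb3 : W.b3 ∉ Y := fun h => (hX' _).1 h (b3_mem_nbhd.2 (Or.inr ha))
  have hl : ∀ i, W.l i ∉ Y := fun i h => (hX' _).1 h (l_mem_nbhd_of_a_mem ha i)
  by_cases hdX : W.d ∈ nbhd N (nbhd N X)
  swap
  · exact Or.inl (compl_nbhd_nbhd_eq_of_a_mem ha hdX)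
  by_cases hcd : W.c1 ∉ Y ∧ W.d ∉ Y
  · exact Or.inr (Or.inl (compl_nbhd_four_eq hne haY hb1 hb2 hb3 hcd.1 hcd.2 hl))
  have hdc : W.d ∈ Y ∧ W.c1 ∉ Y ∧ W.c1 ∉ X := by
    have h1 := hX' .d
    have h2 := hX' .c1
    have h3 := hY' .c1
    have h4 := hY' .d
    simp only [d_mem_nbhd, c1_mem_nbhd] at hdX h1 h2 h3 h4
    tauto
  obtain ⟨hd, hc1, hc1X⟩ := hdc
  by_cases hY1 : Y = {W.d}
  · exact Or.inr (Or.inr (Or.inr (Or.inl hY1)))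
  by_cases hc2 : W.c2 ∈ Y
  swap
  · refine Or.inr (Or.inr (Or.inl ?_))
    -- the other vertices of `Y` are among the `u i`, hence at distance two from `a`
    have haY2 : W.a ∈ nbhd N (nbhd N Y) := by
      obtain ⟨v, hv, hvd⟩ : ∃ v ∈ Y, v ≠ W.d := by
        by_contra! h
        exact hY1 (Set.eq_singleton_iff_nonempty_unique_mem.2 ⟨hne, h⟩)
      cases v with
      | u i hi =>
        exact a_mem_nbhd.2 (Or.inr (Or.inr (Or.inr (Or.inr ⟨i, l_mem_nbhd_of_u_mem hi hv⟩))))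
      | l i => exact absurd hv (hl i)
      | _ => contradiction
    refine compl_nbhd_four_eq (X := (nbhd N (nbhd N (nbhd N Y)))ᶜ) ⟨W.c2, ?_⟩ ?_ ?_ ?_ ?_ ?_ ?_ ?_
    · simp [c2_mem_nbhd, b2_mem_nbhd, a_mem_nbhd, hc2, hb1, hb2, hb3, haY, hl]
    · exact not_not.2 (subset_nbhd haY2)
    · exact not_not.2 (b1_mem_nbhd.2 (Or.inr (Or.inr haY2)))
    · exact not_not.2 (b2_mem_nbhd.2 (Or.inr (Or.inr haY2)))
    · exact not_not.2 (b3_mem_nbhd.2 (Or.inr haY2))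
    · exact not_not.2 (by simp [c1_mem_nbhd, hd])
    · exact not_not.2 (by simp [d_mem_nbhd, hd])
    · exact fun i => not_not.2 (l_mem_nbhd_of_a_mem haY2 i)
  refine Or.inr (Or.inr (Or.inr (Or.inr ?_)))
  have hb2X : W.b2 ∉ X := fun h => (hY' _).1 h (b2_mem_nbhd.2 (Or.inr (Or.inl hc2)))
  have hb3X : W.b3 ∈ X := by rw [hY', b3_mem_nbhd]; tauto
  have h1 : W.c1 ∈ Xᶜ ∩ Yᶜ := ⟨hc1X, hc1⟩
  have h2 : W.b2 ∈ Xᶜ ∩ Yᶜ := ⟨hb2X, hb2⟩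
  apply compl_nbhd_nbhd_eq_of_a_mem
  · refine a_mem_nbhd.2 (Or.inr (Or.inr (Or.inr (Or.inl ?_))))
    rw [Set.mem_compl_iff, b3_mem_nbhd]
    exact not_or.2 ⟨fun h => h.1 hb3X, fun h => h.1 ha⟩
  · have hsep : W.d ∉ (nbhd N (Xᶜ ∩ Yᶜ))ᶜ ∧ W.c1 ∉ (nbhd N (Xᶜ ∩ Yᶜ))ᶜ ∧
        W.b1 ∉ (nbhd N (Xᶜ ∩ Yᶜ))ᶜ ∧ W.a ∉ (nbhd N (Xᶜ ∩ Yᶜ))ᶜ := by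
      exact ⟨not_not.2 (d_mem_nbhd.2 (Or.inr h1)), not_not.2 (subset_nbhd h1),
        not_not.2 (b1_mem_nbhd.2 (Or.inr (Or.inl h1))),
        not_not.2 (a_mem_nbhd.2 (Or.inr (Or.inr (Or.inl h2))))⟩
    obtain ⟨e1, e2, e3, e4⟩ := hsep
    simp only [d_mem_nbhd, c1_mem_nbhd, b1_mem_nbhd, e1, e2, e3, e4, or_self, not_false_eq_true]

end

/-! ### Terms producing `{d}` -/

/-- Terms built from two terms `s` and `t`. If the values of `s` and `t` in `Cm (F N)` are nonempty
sets each of which is the complement of the neighbourhood of the other, then the value of one of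
these terms, or of one of those with `s` and `t` exchanged, is `{d}`. -/
def separatorTerms (s t : UTerm) : Set UTerm :=
  {.compl (.dia (.dia (.dia s))),
    .compl (.dia (.dia (.dia (.dia (.compl (.dia (.dia s))))))),
    .compl (.dia (.dia s)),
    .compl (.dia (.dia (.dia (.dia t)))),
    .compl (.dia (.dia (.dia (.dia (.compl (.dia (.dia (.dia t)))))))),
    t,
    .compl (.dia (.dia (.dia (.compl (.dia (.inf (.compl s) (.compl t)))))))}

theorem finite_separatorTerms (s t : UTerm) : (separatorTerms s t).Finite :=
  Set.toFinite {_, _, _, _, _, _, _}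

section

variable {N : Set ℕ} {X Y : Set W}

theorem nbhd_mono (h : X ⊆ Y) : nbhd N X ⊆ nbhd N Y := fun _ ⟨y, hy, hxy⟩ => ⟨y, h hy, hxy⟩

theorem nbhd_compl_nbhd_subset : nbhd N (nbhd N X)ᶜ ⊆ Xᶜ := by
  rintro x ⟨y, hy, h⟩ hx
  exact hy ⟨x, hx, h.imp Eq.symm SimpleGraph.Adj.symm⟩

theorem nbhd_compl_nbhd_compl_nbhd : nbhd N (nbhd N (nbhd N X)ᶜ)ᶜ = nbhd N X := by
  refine subset_antisymm ?_ (nbhd_mono ?_)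
  · simpa only [compl_compl] using nbhd_compl_nbhd_subset (N := N) (X := (nbhd N X)ᶜ)
  · exact Set.subset_compl_comm.1 nbhd_compl_nbhd_subset

theorem exists_separatorTerms_eval_eq_of_a_mem {s t : UTerm}
    (hs : (nbhd N (t.eval (A := Cm (F N)) X))ᶜ = s.eval (A := Cm (F N)) X)
    (ht : (nbhd N (s.eval (A := Cm (F N)) X))ᶜ = t.eval (A := Cm (F N)) X)
    (ha : W.a ∈ (show Set W from s.eval (A := Cm (F N)) X))
    (hne : (show Set W from t.eval (A := Cm (F N)) X).Nonempty) :
    ∃ p ∈ separatorTerms s t, p.eval (A := Cm (F N)) X = ({W.d} : Set W) := by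
  rcases d_definable_of_a_mem hs ht ha hne with h | h | h | h | h
  · exact ⟨_, .inr (.inr (.inl rfl)), h⟩
  · exact ⟨_, .inr (.inr (.inr (.inl rfl))), h⟩
  · exact ⟨_, .inr (.inr (.inr (.inr (.inl rfl)))), h⟩
  · exact ⟨_, .inr (.inr (.inr (.inr (.inr (.inl rfl))))), h⟩
  · exact ⟨_, .inr (.inr (.inr (.inr (.inr (.inr rfl))))), h⟩

/-- Finitely many terms suffice to produce `{d}` from all nonempty sets of vertices that are not
dominating. The two arguments of `separatorTerms` are evaluated at the complement of the
neighbourhood of the set, and at the complement of the neighbourhood of the latter. -/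
theorem exists_separatorTerms_eval_eq (hX : X.Nonempty) (hne : nbhd N X ≠ Set.univ) :
    ∃ t ∈ separatorTerms (.compl (.dia .var)) (.compl (.dia (.compl (.dia .var)))) ∪
        separatorTerms (.compl (.dia (.compl (.dia .var)))) (.compl (.dia .var)),
      t.eval (A := Cm (F N)) X = ({W.d} : Set W) := by
  have hs : (nbhd N (nbhd N (nbhd N X)ᶜ)ᶜ)ᶜ = (nbhd N X)ᶜ := by rw [nbhd_compl_nbhd_compl_nbhd]
  have hsne : (nbhd N X)ᶜ.Nonempty := Set.nonempty_compl.2 hne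
  have htne : (nbhd N (nbhd N X)ᶜ)ᶜ.Nonempty :=
    hX.mono (Set.subset_compl_comm.1 nbhd_compl_nbhd_subset)
  by_cases ha : W.a ∈ (nbhd N X)ᶜ
  · obtain ⟨p, hp, e⟩ := exists_separatorTerms_eval_eq_of_a_mem (N := N) (X := X)
      (s := .compl (.dia .var)) (t := .compl (.dia (.compl (.dia .var)))) hs rfl ha htne
    exact ⟨p, .inl hp, e⟩
  by_cases ha' : W.a ∈ (nbhd N (nbhd N X)ᶜ)ᶜ
  · obtain ⟨p, hp, e⟩ := exists_separatorTerms_eval_eq_of_a_mem (N := N) (X := X)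
      (s := .compl (.dia (.compl (.dia .var)))) (t := .compl (.dia .var)) rfl hs ha' hsne
    exact ⟨p, .inr hp, e⟩
  rcases d_definable_of_a_notMem hs rfl ha ha' with h | h | h | h
  · exact ⟨_, .inl (.inl rfl), h⟩
  · exact ⟨_, .inr (.inl rfl), h⟩
  · exact ⟨_, .inl (.inr (.inl rfl)), h⟩
  · exact ⟨_, .inr (.inr (.inl rfl)), h⟩

end

/-! ### The algebras `D N` -/

/-- The generator `{d}` of `D N`. -/
def genD (N : Set ℕ) : D N := ⟨({W.d} : Set W), fun _ hT => hT rfl⟩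

theorem genD_generates (N : Set ℕ) (T : KTBSubalgebra (D N)) (hT : genD N ∈ T.carrier) (v : D N) :
    v ∈ T.carrier := by
  let T' : KTBSubalgebra (Cm (F N)) :=
    { carrier := {X | ∃ v ∈ T.carrier, v.1 = X}
      supClosed' := by
        rintro _ ⟨v, hv, rfl⟩ _ ⟨w, hw, rfl⟩
        exact ⟨v ⊔ w, T.supClosed' hv hw, rfl⟩
      infClosed' := by
        rintro _ ⟨v, hv, rfl⟩ _ ⟨w, hw, rfl⟩
        exact ⟨v ⊓ w, T.infClosed' hv hw, rfl⟩
      compl_mem' := by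
        rintro _ ⟨v, hv, rfl⟩
        exact ⟨vᶜ, T.compl_mem' hv, rfl⟩
      bot_mem' := ⟨⊥, T.bot_mem', rfl⟩
      dia_mem' := by
        rintro _ ⟨v, hv, rfl⟩
        exact ⟨dia v, T.dia_mem' v hv, rfl⟩ }
  obtain ⟨w, hw, e⟩ := v.2 T' (by rintro _ rfl; exact ⟨genD N, hT, rfl⟩)
  exact (Subtype.ext e : w = v) ▸ hw

theorem le_Var_complete_two {N : Set ℕ} {V : Subvariety} (hV : V ≤ Var {D N})
    (hD : D N ∉ V.carrier) : V ≤ Var {Cm (⊤ : SimpleGraph (Fin 2))} := by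
  let p : Fin 2 → W := ![.a, .b3]
  let g : BoundedLatticeHom (D N) (Set (Fin 2)) :=
    { toFun := fun X => {j | p j ∈ (show Set W from X.1)}
      map_sup' := fun _ _ => rfl
      map_inf' := fun _ _ => rfl
      map_top' := rfl
      map_bot' := rfl }
  refine le_Var_complete_of_notMem (d := genD N) (genD_generates N) (k := 5) ?_ g
    (τ := separatorTerms (.compl (.dia .var)) (.compl (.dia (.compl (.dia .var)))) ∪
        separatorTerms (.compl (.dia (.compl (.dia .var)))) (.compl (.dia .var)))
    ((finite_separatorTerms _ _).union (finite_separatorTerms _ _)) ?_ hV hD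
  · intro X hX
    refine Subtype.ext (nbhd_five_eq_univ (N := N) (X := X.1) ?_)
    exact Set.nonempty_iff_ne_empty.2 fun h => hX (Subtype.ext h)
  · intro X
    by_cases hX : X = ⊥
    · exact Or.inl hX
    by_cases hdom : nbhd N X.1 = Set.univ
    · refine Or.inr (Or.inl ⟨Subtype.ext hdom, ?_⟩)
      -- the only neighbour of `b3` is `a`, so a dominating set contains one of the two
      have h : W.b3 ∈ nbhd N X.1 := hdom ▸ Set.mem_univ _
      rcases b3_mem_nbhd.1 h with h | h
      · exact ⟨1, h⟩
      · exact ⟨0, h⟩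
    · have hne : (show Set W from X.1).Nonempty :=
        Set.nonempty_iff_ne_empty.2 fun h => hX (Subtype.ext h)
      obtain ⟨t, ht, e⟩ := exists_separatorTerms_eval_eq hne hdom
      exact Or.inr (Or.inr ⟨t, ht, Subtype.ext ((UTerm.coe_eval X t).trans e)⟩)

theorem D_notMem (N : Set ℕ) : D N ∉ (Var {Cm (⊤ : SimpleGraph (Fin 2))}).carrier := by
  refine notMem_Var_of_eval_ne (.dia (.dia .var)) (.dia .var) ?_ (y := genD N) ?_
  · intro X
    rcases (show Set (Fin 2) from X).eq_empty_or_nonempty with rfl | h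
    · exact congrArg dia (dia_bot (A := Cm (⊤ : SimpleGraph (Fin 2))))
    · have e : dia X = (⊤ : Cm (⊤ : SimpleGraph (Fin 2))) := dia_complete_of_nonempty h
      exact (congrArg dia e).trans (dia_top.trans e.symm)
  · intro h
    have e : nbhd N (nbhd N {W.d}) = nbhd N {W.d} := congrArg Subtype.val h
    have h1 : W.b1 ∈ nbhd N (nbhd N {W.d}) := by simp [b1_mem_nbhd, c1_mem_nbhd]
    rw [e] at h1
    simp [b1_mem_nbhd] at h1

/-! ### A partition into two dominating sets -/

/-- A set of vertices of `F N` such that it and its complement are both dominating. -/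
def dominating : Set W := {v | v = .a ∨ v = .c2 ∨ v = .d ∨ ∃ i hi, v = .u i hi}

theorem nbhd_dominating (N : Set ℕ) : nbhd N dominating = Set.univ := by
  refine Set.eq_univ_of_forall fun v => ?_
  cases v with
  | l i => exact l_mem_nbhd_of_a_mem (Or.inl rfl) i
  | u i hi => exact subset_nbhd (Or.inr (Or.inr (Or.inr ⟨i, hi, rfl⟩)))
  | _ => simp [a_mem_nbhd, b1_mem_nbhd, b2_mem_nbhd, b3_mem_nbhd, c1_mem_nbhd, c2_mem_nbhd,
      d_mem_nbhd, dominating]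

theorem nbhd_compl_dominating (N : Set ℕ) : nbhd N dominatingᶜ = Set.univ := by
  refine Set.eq_univ_of_forall fun v => ?_
  cases v with
  | l i => exact subset_nbhd (by simp [dominating])
  | u i hi => exact u_mem_nbhd_of_l_mem hi (by simp [dominating])
  | _ => simp [a_mem_nbhd, b1_mem_nbhd, b2_mem_nbhd, b3_mem_nbhd, c1_mem_nbhd, c2_mem_nbhd,
      d_mem_nbhd, dominating]

theorem l_u_notMem_nbhd {N : Set ℕ} {X : Set W} (ha : W.a ∉ X) (hl : ∀ i, W.l i ∉ X)
    (hu : ∀ i hi, W.u i hi ∉ X) :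
    (∀ i, W.l i ∉ nbhd N X) ∧ ∀ i hi, W.u i hi ∉ nbhd N X := by
  refine ⟨fun i h => ?_, fun i hi h => ?_⟩
  · rw [mem_nbhd_iff] at h
    rcases h with h | ⟨y, hy, -, h | h⟩
    · exact hl i h
    · cases h
      · exact hl _ hy
      all_goals exact hu _ _ hy
    · cases h
      · exact hl _ hy
      · exact ha hy
  · rcases u_mem_nbhd h with h | ⟨j, h⟩
    · exact hu i hi h
    · exact hl j h

/-- The set `dominating` is the union of the spheres around `d` of radius zero, three and five. -/
theorem dominating_eq (N : Set ℕ) :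
    dominating = {W.d} ∪ (nbhd N (nbhd N (nbhd N {W.d})) ∩ (nbhd N (nbhd N {W.d}))ᶜ) ∪
      (nbhd N (nbhd N (nbhd N (nbhd N {W.d}))))ᶜ := by
  obtain ⟨hl1, hu1⟩ := l_u_notMem_nbhd (N := N) (X := {W.d}) (by simp) (by simp) (by simp)
  obtain ⟨hl2, hu2⟩ := l_u_notMem_nbhd (N := N) (X := nbhd N {W.d}) (by simp [a_mem_nbhd]) hl1 hu1
  obtain ⟨hl3, hu3⟩ := l_u_notMem_nbhd (N := N) (X := nbhd N (nbhd N {W.d}))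
    (by simp [a_mem_nbhd, b1_mem_nbhd, b2_mem_nbhd, b3_mem_nbhd, hl1]) hl2 hu2
  have ha : W.a ∈ nbhd N (nbhd N (nbhd N {W.d})) := by
    simp [a_mem_nbhd, b1_mem_nbhd, c1_mem_nbhd]
  ext v
  cases v with
  | l i =>
    have h4 := l_mem_nbhd_of_a_mem (N := N) ha i
    simp [dominating, hl3, h4]
  | u i hi =>
    have h4 : W.u i hi ∉ nbhd N (nbhd N (nbhd N (nbhd N {W.d}))) := fun h => by
      rcases u_mem_nbhd h with h | ⟨j, h⟩
      · exact hu3 i hi h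
      · exact hl3 j h
    simp [dominating, h4, hi]
  | _ => simp [dominating, a_mem_nbhd, b1_mem_nbhd, b2_mem_nbhd, b3_mem_nbhd, c1_mem_nbhd,
      c2_mem_nbhd, d_mem_nbhd, hl1, hl2]

theorem dominating_mem (N : Set ℕ) :
    dominating ∈ (generate (A := Cm (F N)) {({W.d} : Set W)}).carrier := by
  intro T hT
  have h0 : ({W.d} : Set W) ∈ T.carrier := hT rfl
  have h2 := T.dia_mem' _ (T.dia_mem' _ h0)
  have h3 := T.dia_mem' _ h2
  have h4 := T.dia_mem' _ h3
  exact Set.mem_of_eq_of_mem (dominating_eq N)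
    (T.supClosed' (T.supClosed' h0 (T.infClosed' h3 (T.compl_mem' h2))) (T.compl_mem' h4))

/-- The two-colouring of the vertices by membership in `dominating` is a bounded morphism onto the
complete graph on two vertices, and dually its complex algebra embeds into `D N`. -/
theorem complete_two_mem (N : Set ℕ) :
    Cm (⊤ : SimpleGraph (Fin 2)) ∈ (Var {D N}).carrier := by
  classical
  let κ : W → Fin 2 := fun v => if v ∈ dominating then 0 else 1
  have hκ0 : ∀ v, κ v = 0 ↔ v ∈ dominating := fun v => by simp [κ]
  have hκ1 : ∀ v, κ v = 1 ↔ v ∉ dominating := fun v => by simp [κ]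
  have hdom : ∀ j v, ∃ w, κ w = j ∧ (v = w ∨ (F N).Adj v w) := by
    intro j v
    fin_cases j
    · obtain ⟨w, hw, h⟩ : v ∈ nbhd N dominating := nbhd_dominating N ▸ Set.mem_univ v
      exact ⟨w, (hκ0 w).2 hw, h⟩
    · obtain ⟨w, hw, h⟩ : v ∈ nbhd N dominatingᶜ := nbhd_compl_dominating N ▸ Set.mem_univ v
      exact ⟨w, (hκ1 w).2 hw, h⟩
  have hmem : ∀ Y : Set (Fin 2),
      κ ⁻¹' Y ∈ (generate (A := Cm (F N)) {({W.d} : Set W)}).carrier := by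
    intro Y
    have hS := dominating_mem N
    let T := generate (A := Cm (F N)) {({W.d} : Set W)}
    by_cases h0 : (0 : Fin 2) ∈ Y <;> by_cases h1 : (1 : Fin 2) ∈ Y
    · refine Set.mem_of_eq_of_mem ?_ (T.compl_mem' T.bot_mem')
      refine (Set.eq_univ_of_forall fun v => ?_).trans Set.compl_empty.symm
      exact (Fin.forall_fin_two (p := (· ∈ Y))).2 ⟨h0, h1⟩ (κ v)
    · refine Set.mem_of_eq_of_mem (Set.ext fun v => ?_) hS
      by_cases hv : v ∈ dominating <;> simp [κ, hv, h0, h1]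
    · refine Set.mem_of_eq_of_mem (Set.ext fun v => ?_) (T.compl_mem' hS)
      change _ ↔ v ∈ (dominating : Set W)ᶜ
      by_cases hv : v ∈ dominating <;> simp [κ, hv, h0, h1]
    · refine Set.mem_of_eq_of_mem ?_ T.bot_mem'
      refine Set.eq_empty_of_forall_notMem fun v => ?_
      exact (Fin.forall_fin_two (p := (· ∉ Y))).2 ⟨h0, h1⟩ (κ v)
  refine (Var _).mem_of_injective (mem_Var_self (D N)) (fun Y => ⟨κ ⁻¹' Y, hmem Y⟩) ?_ ?_ ?_ ?_ ?_
  · have hsurj : Function.Surjective κ := fun j => (hdom j .a).imp fun _ h => h.1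
    exact fun Y Z h => hsurj.preimage_injective (congrArg Subtype.val h)
  · exact fun _ _ => rfl
  · exact fun _ => rfl
  · rfl
  · intro Y
    refine Subtype.ext ?_
    rcases (show Set (Fin 2) from Y).eq_empty_or_nonempty with rfl | hY
    · have e : dia (A := Cm (⊤ : SimpleGraph (Fin 2))) (∅ : Set (Fin 2)) = (∅ : Set (Fin 2)) :=
        dia_bot (A := Cm (⊤ : SimpleGraph (Fin 2)))
      change κ ⁻¹' (dia (A := Cm (⊤ : SimpleGraph (Fin 2))) (∅ : Set (Fin 2))) = _
      rw [e]
      exact (dia_bot (A := Cm (F N))).symm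
    · change κ ⁻¹' (dia (A := Cm (⊤ : SimpleGraph (Fin 2))) Y) = nbhd N (κ ⁻¹' Y)
      rw [dia_complete_of_nonempty hY]
      obtain ⟨j, hj⟩ := hY
      refine (Set.eq_univ_of_forall fun v => ?_).symm
      obtain ⟨w, rfl, h⟩ := hdom j v
      exact ⟨w, hj, h⟩

end KTB

theorem mainTheorem2 (N : Set ℕ) (hN : N ⊆ KTB.posEven) :
    KTB.HasHeight 3 (KTB.Var {KTB.D N}) ∧
      Order.height (KTB.Var {KTB.D N}) = 3 ∧
      KTB.Var {KTB.Cm (⊤ : SimpleGraph (Fin 2))} ⋖ KTB.Var {KTB.D N} := by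
  have h1 := KTB.covBy_and_height_eq_add_one KTB.bot_lt_Var_complete_one fun V hV => by
    by_contra hne
    exact hV.not_ge (KTB.Var_complete_one_le fun h => hne h.le)
  have lt2 : KTB.Var {KTB.Cm (⊤ : SimpleGraph Unit)} <
      KTB.Var {KTB.Cm (⊤ : SimpleGraph (Fin 2))} := by
    refine lt_of_le_not_ge (KTB.Var_complete_one_le fun h => ?_) fun h =>
      KTB.complete_two_notMem (KTB.Var_singleton_le_iff.1 h)
    refine KTB.complete_two_notMem ?_
    exact (h.le.trans bot_le) (KTB.mem_Var_self _)
  have h2 := KTB.covBy_and_height_eq_add_one lt2 fun V hV =>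
    KTB.le_Var_complete_one hV.le fun h => hV.not_ge (KTB.Var_singleton_le_iff.2 h)
  have lt3 : KTB.Var {KTB.Cm (⊤ : SimpleGraph (Fin 2))} < KTB.Var {KTB.D N} :=
    lt_of_le_not_ge (KTB.Var_singleton_le_iff.2 (KTB.complete_two_mem N)) fun h =>
      KTB.D_notMem N (KTB.Var_singleton_le_iff.1 h)
  have h3 := KTB.covBy_and_height_eq_add_one lt3 fun V hV =>
    KTB.le_Var_complete_two hV.le fun h => hV.not_ge (KTB.Var_singleton_le_iff.2 h)
  refine ⟨⟨fun i => match i with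
      | 0 => ⊥
      | 1 => KTB.Var {KTB.Cm (⊤ : SimpleGraph Unit)}
      | 2 => KTB.Var {KTB.Cm (⊤ : SimpleGraph (Fin 2))}
      | _ => KTB.Var {KTB.D N}, rfl, rfl, fun i hi => ?_⟩, ?_, h3.1⟩
  · interval_cases i
    exacts [h1.1, h2.1, h3.1]
  · rw [h3.2, h2.2, h1.2, Order.height_bot]
    norm_num
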